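/- Let $k$ be a field and let $\Lambda$ be an associative $k$-algebra, not assumed to have a unity element. Let $r(\Lambda)$ denote its Jacobson radical. Call $\Lambda$ *elementary* if it is finite dimensional over $k$, has a unity element, and $\Lambda/r(\Lambda)\cong k^n$ as $k$-algebras for some $n\ge 1$. Say that $\Lambda$ *can be lifted* if there is a (not necessarily unital) subalgebra $A$ of $\Lambda$ such that $\Lambda=A\oplus r(\Lambda)$ as vector spaces. For a directed graph $D$ (loops and multiple arrows allowed), let $kD$ be its path algebra: it has as $k$-basis all paths of $D$, including the trivial path at each vertex, and the product of two paths is their concatenation if the first ends where the second starts, and $0$ otherwise. Let $J$ be the two-sided ideal of $kD$ generated by all arrows. A *path algebra of a finite directed graph with relations* is an algebra $kD/(\rho)$, where $D$ has finitely many (and at least one) vertices and finitely many arrows, and $\rho$ is a non-empty subset of $kD$ such that the two-sided ideal $(\rho)$ generated by $\rho$ satisfies $J^t\subseteq(\rho)\subseteq J^2$ for some natural number $t$. Then $\Lambda$ is an elementary algebra which can be lifted if and only if $\Lambda$ is isomorphic, as a $k$-algebra, to a path algebra of a finite directed graph with relations. -/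

import Mathlib

universe u v w w'

/-! ### Ideals and quotients of associative algebras, possibly without unity -/

section Ideals

variable {k : Type u} {A : Type v} [Field k] [NonUnitalRing A] [Module k A]

/-- A two-sided ideal of a (possibly non-unital) `k`-algebra: a `k`-subspace closed under left and
right multiplication by arbitrary elements. -/
structure AlgIdeal (k : Type u) (A : Type v) [Field k] [NonUnitalRing A] [Module k A]
    extends Submodule k A where
  mul_mem_left' : ∀ a x : A, x ∈ carrier → a * x ∈ carrier
  mul_mem_right' : ∀ x a : A, x ∈ carrier → x * a ∈ carrier

namespace AlgIdeal

instance : SetLike (AlgIdeal k A) A where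
  coe I := I.carrier
  coe_injective := by
    rintro ⟨I, _, _⟩ ⟨J, _, _⟩ h
    have : I = J := SetLike.coe_injective h
    subst this
    rfl

/-- Ideals are ordered by inclusion. -/
instance : PartialOrder (AlgIdeal k A) := PartialOrder.ofSetLike (AlgIdeal k A) A

theorem mem_toSubmodule {I : AlgIdeal k A} {x : A} : x ∈ I.toSubmodule ↔ x ∈ I := Iff.rfl

theorem mul_mem_left (I : AlgIdeal k A) (a : A) {x : A} (hx : x ∈ I) : a * x ∈ I :=
  I.mul_mem_left' a x hx

theorem mul_mem_right (I : AlgIdeal k A) (a : A) {x : A} (hx : x ∈ I) : x * a ∈ I :=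
  I.mul_mem_right' x a hx

/-- The whole algebra, as an ideal. -/
def whole (k : Type u) (A : Type v) [Field k] [NonUnitalRing A] [Module k A] : AlgIdeal k A where
  toSubmodule := ⊤
  mul_mem_left' _ _ _ := trivial
  mul_mem_right' _ _ _ := trivial

/-- The ideal generated by a subset: the smallest two-sided ideal containing it. -/
def gen (k : Type u) {A : Type v} [Field k] [NonUnitalRing A] [Module k A] (S : Set A) :
    AlgIdeal k A where
  carrier := {x | ∀ I : AlgIdeal k A, S ⊆ (I : Set A) → x ∈ I}
  add_mem' hx hy I hI := I.add_mem (hx I hI) (hy I hI)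
  zero_mem' I _ := I.zero_mem
  smul_mem' c _ hx I hI := I.smul_mem c (hx I hI)
  mul_mem_left' a _ hx I hI := I.mul_mem_left a (hx I hI)
  mul_mem_right' _ a hx I hI := I.mul_mem_right a (hx I hI)

/-- The product `I J` of two ideals: the ideal generated by all `x * y`, `x ∈ I`, `y ∈ J`. -/
def prod (I J : AlgIdeal k A) : AlgIdeal k A :=
  gen k {z | ∃ x ∈ I, ∃ y ∈ J, x * y = z}

/-- Powers of an ideal, `I ^ 0` being the whole algebra and `I ^ 1 = I`. -/
def pow (I : AlgIdeal k A) : ℕ → AlgIdeal k A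
  | 0 => whole k A
  | 1 => I
  | n + 2 => prod I (pow I (n + 1))

/-- The quotient algebra `A / I`. -/
def Quot (I : AlgIdeal k A) : Type v := A ⧸ I.toSubmodule

noncomputable instance (I : AlgIdeal k A) : AddCommGroup I.Quot :=
  inferInstanceAs (AddCommGroup (A ⧸ I.toSubmodule))

noncomputable instance (I : AlgIdeal k A) : Module k I.Quot :=
  inferInstanceAs (Module k (A ⧸ I.toSubmodule))

/-- The canonical projection `A → A / I`. -/
def proj (I : AlgIdeal k A) : A →ₗ[k] I.Quot := I.toSubmodule.mkQ

theorem proj_surjective (I : AlgIdeal k A) : Function.Surjective I.proj :=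
  I.toSubmodule.mkQ_surjective

theorem proj_eq_proj (I : AlgIdeal k A) {x y : A} : I.proj x = I.proj y ↔ x - y ∈ I :=
  Submodule.Quotient.eq I.toSubmodule

/-- Multiplication of `A / I`, induced by that of `A`. -/
instance (I : AlgIdeal k A) : Mul I.Quot where
  mul := Quotient.map₂ (· * ·) <| by
    intro a b hab c d hcd
    have h1 : a - b ∈ I := (Submodule.quotientRel_def I.toSubmodule).1 hab
    have h2 : c - d ∈ I := (Submodule.quotientRel_def I.toSubmodule).1 hcd
    refine (Submodule.quotientRel_def I.toSubmodule).2 ?_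
    have h : a * c - b * d = (a - b) * c + b * (c - d) := by noncomm_ring
    change a * c - b * d ∈ I.toSubmodule
    rw [h]
    exact I.add_mem (I.mul_mem_right c h1) (I.mul_mem_left b h2)

theorem proj_mul (I : AlgIdeal k A) (x y : A) : I.proj (x * y) = I.proj x * I.proj y := rfl

noncomputable instance (I : AlgIdeal k A) : NonUnitalRing I.Quot where
  left_distrib a b c := by
    obtain ⟨a, rfl⟩ := I.proj_surjective a
    obtain ⟨b, rfl⟩ := I.proj_surjective b
    obtain ⟨c, rfl⟩ := I.proj_surjective c
    simp only [← map_add, ← proj_mul, mul_add]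
  right_distrib a b c := by
    obtain ⟨a, rfl⟩ := I.proj_surjective a
    obtain ⟨b, rfl⟩ := I.proj_surjective b
    obtain ⟨c, rfl⟩ := I.proj_surjective c
    simp only [← map_add, ← proj_mul, add_mul]
  zero_mul a := by
    obtain ⟨a, rfl⟩ := I.proj_surjective a
    rw [← map_zero I.proj, ← proj_mul, zero_mul]
  mul_zero a := by
    obtain ⟨a, rfl⟩ := I.proj_surjective a
    rw [← map_zero I.proj, ← proj_mul, mul_zero]
  mul_assoc a b c := by
    obtain ⟨a, rfl⟩ := I.proj_surjective a
    obtain ⟨b, rfl⟩ := I.proj_surjective b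
    obtain ⟨c, rfl⟩ := I.proj_surjective c
    simp only [← proj_mul, mul_assoc]

instance [IsScalarTower k A A] (I : AlgIdeal k A) : IsScalarTower k I.Quot I.Quot where
  smul_assoc c a b := by
    obtain ⟨a, rfl⟩ := I.proj_surjective a
    obtain ⟨b, rfl⟩ := I.proj_surjective b
    simp only [smul_eq_mul, ← map_smul, ← proj_mul, smul_mul_assoc]

instance [SMulCommClass k A A] (I : AlgIdeal k A) : SMulCommClass k I.Quot I.Quot where
  smul_comm c a b := by
    obtain ⟨a, rfl⟩ := I.proj_surjective a
    obtain ⟨b, rfl⟩ := I.proj_surjective b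
    simp only [smul_eq_mul, ← map_smul, ← proj_mul, mul_smul_comm]

end AlgIdeal

end Ideals

/-! ### The Jacobson radical, liftable algebras, elementary algebras -/

section Radical

variable {k : Type u} {A : Type v} [Field k] [NonUnitalRing A] [Module k A]
  [IsScalarTower k A A] [SMulCommClass k A A]

/-- All `a * x` are quasi-regular if and only if `x` lies in the Jacobson radical of the algebra
obtained from `A` by adjoining a unity. -/
theorem forall_isQuasiregular_mul_iff (k : Type u) {A : Type v} [Field k] [NonUnitalRing A]
    [Module k A] [IsScalarTower k A A] [SMulCommClass k A A] (x : A) :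
    (∀ a : A, IsQuasiregular (a * x)) ↔
      (x : Unitization k A) ∈ Ideal.jacobson (⊥ : Ideal (Unitization k A)) := by
  simp only [isQuasiregular_iff_isUnit' k, Unitization.inr_mul, Ideal.mem_jacobson_iff,
    Ideal.mem_bot]
  constructor
  · intro h y
    obtain ⟨b, hb⟩ : ∃ b : A, (y * x : Unitization k A) = b := by
      refine ⟨(y * x : Unitization k A).snd, ?_⟩
      ext <;> simp
    obtain ⟨c, hc⟩ : ∃ c : A, (b : Unitization k A) * y = c := by
      refine ⟨((b : Unitization k A) * y).snd, ?_⟩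
      ext <;> simp
    obtain ⟨u, hu⟩ := h (-c)
    have e : ((-c : A) : Unitization k A) * x = -(y * x * (y * x)) := by
      rw [Unitization.inr_neg, ← hc, ← hb]
      noncomm_ring
    rw [e] at hu
    refine ⟨↑u⁻¹ * (1 - y * x), ?_⟩
    have : (↑u⁻¹ : Unitization k A) * (1 - y * x) * y * x + ↑u⁻¹ * (1 - y * x)
        = ↑u⁻¹ * (1 + -(y * x * (y * x))) := by
      noncomm_ring
    rw [this, ← hu, Units.inv_mul, sub_self]
  · intro h a
    obtain ⟨z, hz⟩ := h a
    have hz1 : z * (1 + a * x) = 1 := by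
      rw [← sub_eq_zero, ← hz]
      noncomm_ring
    obtain ⟨s, hs⟩ := h (-(z * a))
    have hs1 : s * z = 1 := by
      have e1 : z = 1 - z * a * x := by
        rw [eq_sub_iff_add_eq, ← hz1]
        noncomm_ring
      have e2 : s * (-(z * a)) * x + s - 1 = s * (1 - z * a * x) - 1 := by
        noncomm_ring
      rw [e2, ← e1, sub_eq_zero] at hs
      exact hs
    have hs2 : s = 1 + a * x := by
      calc s = s * (z * (1 + a * x)) := by rw [hz1, mul_one]
        _ = 1 + a * x := by rw [← mul_assoc, hs1, one_mul]
    exact ⟨⟨1 + a * x, z, by rw [← hs2, hs1], hz1⟩, rfl⟩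

/-- The Jacobson radical `r(A)` of a (possibly non-unital) algebra: the set of all `x` such that
`a * x` is quasi-regular for every `a`. -/
def jacobsonRadical (k : Type u) (A : Type v) [Field k] [NonUnitalRing A] [Module k A]
    [IsScalarTower k A A] [SMulCommClass k A A] : AlgIdeal k A where
  carrier := {x | ∀ a : A, IsQuasiregular (a * x)}
  add_mem' {x y} hx hy := by
    rw [Set.mem_ofPred_eq, forall_isQuasiregular_mul_iff k] at *
    rw [Unitization.inr_add]
    exact Ideal.add_mem _ hx hy
  zero_mem' a := by rw [mul_zero]; exact ⟨1, rfl⟩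
  smul_mem' c x hx a := by
    rw [mul_smul_comm, ← smul_mul_assoc]
    exact hx _
  mul_mem_left' b x hx a := by
    rw [← mul_assoc]
    exact hx _
  mul_mem_right' x b hx := by
    rw [Set.mem_ofPred_eq, forall_isQuasiregular_mul_iff k] at *
    rw [Unitization.inr_mul]
    exact Ideal.mul_mem_right _ _ hx

/-- The algebra `A` can be lifted: `A = B ⊕ r(A)` as vector spaces for some subalgebra `B`. -/
def CanBeLifted (k : Type u) (A : Type v) [Field k] [NonUnitalRing A] [Module k A]
    [IsScalarTower k A A] [SMulCommClass k A A] : Prop :=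
  ∃ B : NonUnitalSubalgebra k A, IsCompl B.toSubmodule (jacobsonRadical k A).toSubmodule

/-- Two algebras are isomorphic: there is a bijective homomorphism of algebras between them. -/
def AlgIsomorphic (k : Type u) (A : Type v) (B : Type w) [Field k] [NonUnitalRing A] [Module k A]
    [NonUnitalRing B] [Module k B] : Prop :=
  ∃ f : A →ₙₐ[k] B, Function.Bijective f

/-- `A` is an elementary algebra: it is finite dimensional, has a unity element, and
`A / r(A) ≅ k × ⋯ × k` with finitely many, and at least one, factors. -/
structure IsElementary (k : Type u) (A : Type v) [Field k] [NonUnitalRing A] [Module k A]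
    [IsScalarTower k A A] [SMulCommClass k A A] : Prop where
  finiteDimensional : Module.Finite k A
  exists_unity : ∃ e : A, ∀ x : A, e * x = x ∧ x * e = x
  quotient_iso : ∃ n : ℕ, 0 < n ∧ AlgIsomorphic k (jacobsonRadical k A).Quot (Fin n → k)

end Radical

/-! ### Path algebras -/

section PathAlgebra

/-- A path of a quiver, of any length (including the trivial paths) and with any end points. -/
@[ext] structure QuiverPath (V : Type w) [Quiver.{w'} V] where
  src : V
  tgt : V
  path : Quiver.Path src tgt

open Classical in
/-- The composite `p q` (first `p`, then `q`) of two paths, defined when `p` ends where `q`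
starts. -/
noncomputable def QuiverPath.comp? {V : Type w} [Quiver.{w'} V] (p q : QuiverPath V) :
    Option (QuiverPath V) :=
  if h : p.tgt = q.src then some ⟨p.src, q.tgt, p.path.comp (q.path.cast h.symm rfl)⟩ else none

theorem QuiverPath.comp?_assoc {V : Type w} [Quiver.{w'} V] (p q r : QuiverPath V) :
    (p.comp? q).bind (fun s => s.comp? r) = (q.comp? r).bind (fun s => p.comp? s) := by
  obtain ⟨a, b, p⟩ := p
  obtain ⟨c, d, q⟩ := q
  obtain ⟨e, f, r⟩ := r
  by_cases h1 : b = c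
  · subst h1
    by_cases h2 : d = e
    · subst h2
      simp [QuiverPath.comp?, Quiver.Path.comp_assoc]
    · simp [QuiverPath.comp?, h2]
  · by_cases h2 : d = e
    · subst h2
      simp [QuiverPath.comp?, h1]
    · simp [QuiverPath.comp?, h1, h2]

/-- The path algebra `kD` of a quiver: the vector space with basis the paths. -/
def PathAlgebra (k : Type u) (V : Type w) [Field k] [Quiver.{w'} V] : Type (max u w w') :=
  QuiverPath V →₀ k

namespace PathAlgebra

variable {k : Type u} {V : Type w} [Field k] [Quiver.{w'} V]

noncomputable instance : AddCommGroup (PathAlgebra k V) :=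
  inferInstanceAs (AddCommGroup (QuiverPath V →₀ k))

noncomputable instance : Module k (PathAlgebra k V) :=
  inferInstanceAs (Module k (QuiverPath V →₀ k))

/-- The basis element given by a path. -/
noncomputable def ofPath (k : Type u) {V : Type w} [Field k] [Quiver.{w'} V] (p : QuiverPath V) :
    PathAlgebra k V :=
  Finsupp.single p (1 : k)

/-- The paths form a basis of the path algebra. -/
noncomputable def pathBasis (k : Type u) (V : Type w) [Field k] [Quiver.{w'} V] :
    Module.Basis (QuiverPath V) k (PathAlgebra k V) :=
  Module.Basis.ofRepr (LinearEquiv.refl k (QuiverPath V →₀ k))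

theorem pathBasis_apply (p : QuiverPath V) : pathBasis k V p = ofPath k p := rfl

/-- The element of the path algebra given by a path, or `0` if there is none. -/
noncomputable def ofOption (k : Type u) {V : Type w} [Field k] [Quiver.{w'} V] :
    Option (QuiverPath V) → PathAlgebra k V
  | none => 0
  | some p => ofPath k p

/-- The bilinear multiplication which sends a pair of paths to their composite if it is defined,
and to `0` otherwise. -/
noncomputable def mulMap (k : Type u) (V : Type w) [Field k] [Quiver.{w'} V] :
    PathAlgebra k V →ₗ[k] PathAlgebra k V →ₗ[k] PathAlgebra k V :=
  (pathBasis k V).constr k fun p => (pathBasis k V).constr k fun q => ofOption k (p.comp? q)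

noncomputable instance : Mul (PathAlgebra k V) := ⟨fun x y => mulMap k V x y⟩

theorem mul_def (x y : PathAlgebra k V) : x * y = mulMap k V x y := rfl

theorem ofPath_mul_ofPath (p q : QuiverPath V) :
    ofPath k p * ofPath k q = ofOption k (p.comp? q) := by
  rw [mul_def, mulMap, ← pathBasis_apply, ← pathBasis_apply, Module.Basis.constr_basis,
    Module.Basis.constr_basis]

theorem mulMap_assoc (x y z : PathAlgebra k V) :
    mulMap k V (mulMap k V x y) z = mulMap k V x (mulMap k V y z) := by
  have key : ∀ p q r : QuiverPath V, mulMap k V (mulMap k V (ofPath k p) (ofPath k q)) (ofPath k r)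
      = mulMap k V (ofPath k p) (mulMap k V (ofPath k q) (ofPath k r)) := by
    intro p q r
    have h := QuiverPath.comp?_assoc p q r
    simp only [← mul_def, ofPath_mul_ofPath]
    have h1 : ofOption k (p.comp? q) * ofPath k r
        = ofOption k ((p.comp? q).bind (fun s => s.comp? r)) := by
      cases p.comp? q with
      | none => simp [ofOption, mul_def]
      | some s => exact ofPath_mul_ofPath s r
    have h2 : ofPath k p * ofOption k (q.comp? r)
        = ofOption k ((q.comp? r).bind (fun s => p.comp? s)) := by
      cases q.comp? r with
      | none => simp [ofOption, mul_def]
      | some s => exact ofPath_mul_ofPath p s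
    rw [h1, h2, h]
  let L : PathAlgebra k V →ₗ[k] PathAlgebra k V →ₗ[k] PathAlgebra k V →ₗ[k] PathAlgebra k V :=
    (LinearMap.compr₂ (mulMap k V) (mulMap k V))
  let R : PathAlgebra k V →ₗ[k] PathAlgebra k V →ₗ[k] PathAlgebra k V →ₗ[k] PathAlgebra k V :=
    (LinearMap.llcomp k _ _ _).flip (mulMap k V) ∘ₗ
      ((LinearMap.llcomp k (PathAlgebra k V) (PathAlgebra k V) (PathAlgebra k V)) ∘ₗ mulMap k V)
  have hLR : L = R := by
    refine (pathBasis k V).ext fun p => (pathBasis k V).ext fun q => (pathBasis k V).ext fun r => ?_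
    exact key p q r
  exact congrArg (fun T => T x y z) hLR

noncomputable instance : NonUnitalRing (PathAlgebra k V) where
  left_distrib x y z := by simp only [mul_def, map_add]
  right_distrib x y z := by simp only [mul_def, map_add, LinearMap.add_apply]
  zero_mul x := by simp only [mul_def, map_zero, LinearMap.zero_apply]
  mul_zero x := by simp only [mul_def, map_zero]
  mul_assoc x y z := mulMap_assoc x y z

instance : IsScalarTower k (PathAlgebra k V) (PathAlgebra k V) where
  smul_assoc c x y := by
    simp only [smul_eq_mul, mul_def, map_smul, LinearMap.smul_apply]

instance : SMulCommClass k (PathAlgebra k V) (PathAlgebra k V) where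
  smul_comm c x y := by
    simp only [smul_eq_mul, mul_def, map_smul]

/-- The ideal `J` of the path algebra generated by all arrows. -/
noncomputable def arrowIdeal (k : Type u) (V : Type w) [Field k] [Quiver.{w'} V] :
    AlgIdeal k (PathAlgebra k V) :=
  AlgIdeal.gen k {x | ∃ (i j : V) (α : i ⟶ j), x = ofPath k ⟨i, j, α.toPath⟩}

end PathAlgebra

/-- `ρ` is a set of relations on the path algebra: it is non-empty, and the ideal `(ρ)` it
generates satisfies `J ^ t ⊆ (ρ) ⊆ J ^ 2` for some `t`. -/
def IsRelationSet {k : Type u} {V : Type w} [Field k] [Quiver.{w'} V]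
    (ρ : Set (PathAlgebra k V)) : Prop :=
  ρ.Nonempty ∧
    (∃ t : ℕ, (PathAlgebra.arrowIdeal k V).pow t ≤ AlgIdeal.gen k ρ) ∧
    AlgIdeal.gen k ρ ≤ (PathAlgebra.arrowIdeal k V).pow 2

end PathAlgebra

/-! Everything rests on the length filtration: `J ^ n` is the span of the paths of length at least
`n` (`arrowIdeal_pow`).

Quotients of path algebras: if `J ^ t ⊆ I ⊆ J ^ 2`, the augmentation `kD → k^V`, whose kernel is
`J`, factors through `kD / I`. The induced map is split by the vertex idempotents and its kernel `J
/ I` is nil; hence this kernel is the radical, and the span of the vertices is a complementary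
subalgebra (`jacobsonRadical_eq_ker`, `isElementary_and_canBeLifted_of_split`).

Presentations: let `R` be the radical of a lifted elementary algebra. The lift is a copy of `k^n`,
which supplies complete orthogonal idempotents `e a`. These are the vertices; the arrows from `a` to
`b` are elements of `e a * R * e b` forming a basis modulo `R ^ 2`. Evaluation `f` on paths is
surjective, because its image is a subalgebra `S` with `R ⊆ S + R ^ 2` and `R` is nilpotent
(`Submodule.le_of_le_sup_sq`). It kills `J ^ (t + 1)` if `R ^ t = 0`. Followed by the projection to
`k^n` it is the augmentation, so `ker f ⊆ J`; modulo `R ^ 2` the corner `e a * f z * e b` is the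
combination of arrows with the coefficients of `z`, so independence gives `ker f ⊆ J ^ 2`
(`ker_eval_le`). The whole kernel serves as the set of relations. -/

namespace AlgIdeal

/-! ### Generated ideals, kernels and maps out of quotients. -/

variable {k : Type u} {A : Type v} [Field k] [NonUnitalRing A] [Module k A]

theorem subset_gen (S : Set A) : S ⊆ (gen k S : Set A) := fun _ hx _ hI => hI hx

theorem gen_le {S : Set A} {I : AlgIdeal k A} : gen k S ≤ I ↔ S ⊆ (I : Set A) :=
  ⟨fun h => (subset_gen S).trans h, fun h _ hx => hx I h⟩

theorem gen_coe (I : AlgIdeal k A) : gen k (I : Set A) = I :=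
  le_antisymm (gen_le.2 subset_rfl) (subset_gen (k := k) _)

theorem prod_le {I J K : AlgIdeal k A} :
    prod I J ≤ K ↔ ∀ x ∈ I, ∀ y ∈ J, x * y ∈ K := by
  rw [prod, gen_le]
  exact ⟨fun h x hx y hy => h ⟨x, hx, y, hy, rfl⟩, by rintro h _ ⟨x, hx, y, hy, rfl⟩; exact h x hx y hy⟩

theorem mul_mem_prod {I J : AlgIdeal k A} {x y : A} (hx : x ∈ I) (hy : y ∈ J) :
    x * y ∈ prod I J :=
  subset_gen (k := k) _ ⟨x, hx, y, hy, rfl⟩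

variable {B : Type w} [NonUnitalRing B] [Module k B]

/-- The kernel of a homomorphism of algebras, as an ideal. -/
def ker (f : A →ₙₐ[k] B) : AlgIdeal k A where
  carrier := {x | f x = 0}
  add_mem' {x y} hx hy := by
    rw [Set.mem_ofPred_eq] at *
    rw [map_add, hx, hy, add_zero]
  zero_mem' := map_zero f
  smul_mem' c x hx := by
    rw [Set.mem_ofPred_eq] at *
    rw [map_smul, hx, smul_zero]
  mul_mem_left' a x hx := by
    rw [Set.mem_ofPred_eq] at *
    rw [map_mul, hx, mul_zero]
  mul_mem_right' x a hx := by
    rw [Set.mem_ofPred_eq] at *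
    rw [map_mul, hx, zero_mul]

theorem mem_ker {f : A →ₙₐ[k] B} {x : A} : x ∈ ker f ↔ f x = 0 := Iff.rfl

/-- The canonical projection as a homomorphism of algebras. -/
noncomputable def projHom (I : AlgIdeal k A) : A →ₙₐ[k] I.Quot where
  toFun := I.proj
  map_smul' c x := map_smul I.proj c x
  map_zero' := map_zero I.proj
  map_add' x y := map_add I.proj x y
  map_mul' x y := I.proj_mul x y

theorem projHom_surjective (I : AlgIdeal k A) : Function.Surjective I.projHom := I.proj_surjective

theorem projHom_eq_zero {I : AlgIdeal k A} {x : A} : I.projHom x = 0 ↔ x ∈ I := by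
  have h := I.proj_eq_proj (x := x) (y := 0)
  rwa [map_zero, sub_zero] at h

/-- The homomorphism induced on the quotient by an ideal contained in the kernel. -/
noncomputable def lift (I : AlgIdeal k A) (f : A →ₙₐ[k] B) (h : I ≤ ker f) : I.Quot →ₙₐ[k] B :=
  let l : I.Quot →ₗ[k] B := I.toSubmodule.liftQ (f : A →ₗ[k] B) fun _ hx => h hx
  have hl : ∀ x, l (I.proj x) = f x := fun _ => rfl
  { toFun := l
    map_smul' := fun c x => map_smul l c x
    map_zero' := map_zero l
    map_add' := fun x y => map_add l x y
    map_mul' := fun x y => by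
      obtain ⟨x, rfl⟩ := I.proj_surjective x
      obtain ⟨y, rfl⟩ := I.proj_surjective y
      rw [← proj_mul, hl, hl, hl, map_mul] }

theorem lift_projHom (I : AlgIdeal k A) (f : A →ₙₐ[k] B) (h : I ≤ ker f) (x : A) :
    I.lift f h (I.projHom x) = f x := rfl

end AlgIdeal

section Iso

variable {k : Type u} {A : Type v} {B : Type w} {C : Type w'} [Field k] [NonUnitalRing A]
  [Module k A] [NonUnitalRing B] [Module k B] [NonUnitalRing C] [Module k C]

theorem AlgIsomorphic.symm (h : AlgIsomorphic k A B) : AlgIsomorphic k B A := by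
  obtain ⟨f, hf⟩ := h
  let e := Equiv.ofBijective f hf
  have h1 : Function.LeftInverse e.symm f := e.left_inv
  have h2 : Function.RightInverse e.symm f := e.right_inv
  exact ⟨f.inverse e.symm h1 h2, e.symm.bijective⟩

theorem AlgIsomorphic.trans (h : AlgIsomorphic k A B) (h' : AlgIsomorphic k B C) :
    AlgIsomorphic k A C := by
  obtain ⟨f, hf⟩ := h
  obtain ⟨g, hg⟩ := h'
  exact ⟨g.comp f, hg.comp hf⟩

theorem AlgIdeal.quot_isomorphic (I : AlgIdeal k A) (f : A →ₙₐ[k] B)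
    (hf : Function.Surjective f) (hI : I = AlgIdeal.ker f) : AlgIsomorphic k I.Quot B := by
  refine ⟨I.lift f hI.le, ?_, fun y => ?_⟩
  · rw [injective_iff_map_eq_zero]
    intro x hx
    obtain ⟨x, rfl⟩ := I.projHom_surjective x
    rw [AlgIdeal.lift_projHom] at hx
    rw [AlgIdeal.projHom_eq_zero, hI]
    exact hx
  · obtain ⟨x, rfl⟩ := hf y
    exact ⟨I.projHom x, I.lift_projHom f hI.le x⟩

end Iso

/-! ### The filtration of the path algebra by path length. -/

namespace PathAlgebra

variable {k : Type u} {V : Type w} [Field k] [Quiver.{w'} V]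

theorem ofPath_mul_ofPath_comp {a b c : V} (p : Quiver.Path a b) (q : Quiver.Path b c) :
    ofPath k ⟨a, b, p⟩ * ofPath k ⟨b, c, q⟩ = ofPath k ⟨a, c, p.comp q⟩ := by
  rw [ofPath_mul_ofPath]
  simp [QuiverPath.comp?, ofOption]

theorem ofPath_mul_ofPath_of_ne {p q : QuiverPath V} (h : p.tgt ≠ q.src) :
    ofPath k p * ofPath k q = 0 := by
  rw [ofPath_mul_ofPath]
  simp [QuiverPath.comp?, ofOption, h]

/-- The coefficient of a path. -/
noncomputable def coeff (p : QuiverPath V) : PathAlgebra k V →ₗ[k] k :=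
  (pathBasis k V).coord p

open Classical in
theorem coeff_ofPath (p q : QuiverPath V) :
    coeff p (ofPath k q) = if q = p then 1 else 0 := by
  rw [← pathBasis_apply, coeff, Module.Basis.coord_apply, Module.Basis.repr_self,
    Finsupp.single_apply]

/-- The elements which are combinations of paths of length at least `n`. -/
noncomputable def lengthSubmodule (k : Type u) (V : Type w) [Field k] [Quiver.{w'} V] (n : ℕ) :
    Submodule k (PathAlgebra k V) :=
  Submodule.span k (ofPath k '' {p | n ≤ p.path.length})

theorem ofPath_mem_lengthSubmodule {n : ℕ} {p : QuiverPath V} (h : n ≤ p.path.length) :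
    ofPath k p ∈ lengthSubmodule k V n :=
  Submodule.subset_span ⟨p, h, rfl⟩

theorem lengthSubmodule_zero : lengthSubmodule k V 0 = ⊤ := by
  rw [eq_top_iff, ← (pathBasis k V).span_eq, Submodule.span_le]
  rintro _ ⟨p, rfl⟩
  exact ofPath_mem_lengthSubmodule (Nat.zero_le _)

theorem mem_lengthSubmodule_iff {n : ℕ} {x : PathAlgebra k V} :
    x ∈ lengthSubmodule k V n ↔ ∀ p : QuiverPath V, p.path.length < n → coeff p x = 0 := by
  have : lengthSubmodule k V n = Finsupp.supported k k {p : QuiverPath V | n ≤ p.path.length} :=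
    (Finsupp.supported_eq_span_single k _).symm
  rw [this]
  refine (Finsupp.mem_supported' k (s := {p : QuiverPath V | n ≤ p.path.length}) x).trans ?_
  exact forall_congr' fun p => imp_congr_left (by simp)

theorem mul_mem_lengthSubmodule {m n : ℕ} {x y : PathAlgebra k V}
    (hx : x ∈ lengthSubmodule k V m) (hy : y ∈ lengthSubmodule k V n) :
    x * y ∈ lengthSubmodule k V (m + n) := by
  induction hx using Submodule.span_induction with
  | zero => rw [zero_mul]; exact zero_mem _
  | add a b _ _ ha hb => rw [add_mul]; exact add_mem ha hb
  | smul c a _ ha => rw [smul_mul_assoc]; exact Submodule.smul_mem _ c ha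
  | mem x hx =>
    obtain ⟨⟨a, b, p⟩, hp, rfl⟩ := hx
    induction hy using Submodule.span_induction with
    | zero => rw [mul_zero]; exact zero_mem _
    | add a b _ _ ha hb => rw [mul_add]; exact add_mem ha hb
    | smul c a _ ha => rw [mul_smul_comm]; exact Submodule.smul_mem _ c ha
    | mem y hy =>
      obtain ⟨⟨c, d, q⟩, hq, rfl⟩ := hy
      by_cases h : b = c
      · subst h
        rw [ofPath_mul_ofPath_comp]
        apply ofPath_mem_lengthSubmodule
        rw [Set.mem_ofPred_eq] at hp hq
        simp only [Quiver.Path.length_comp]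
        exact add_le_add hp hq
      · rw [ofPath_mul_ofPath_of_ne h]
        exact zero_mem _

/-- The ideal of all combinations of paths of length at least `n`. -/
noncomputable def lengthIdeal (k : Type u) (V : Type w) [Field k] [Quiver.{w'} V] (n : ℕ) :
    AlgIdeal k (PathAlgebra k V) where
  toSubmodule := lengthSubmodule k V n
  mul_mem_left' a x hx := by
    have ha : a ∈ lengthSubmodule k V 0 := by rw [lengthSubmodule_zero]; trivial
    have h := mul_mem_lengthSubmodule ha hx
    rw [zero_add] at h
    exact h
  mul_mem_right' x a hx := by
    have ha : a ∈ lengthSubmodule k V 0 := by rw [lengthSubmodule_zero]; trivial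
    have h := mul_mem_lengthSubmodule hx ha
    rw [add_zero] at h
    exact h

theorem mem_lengthIdeal {n : ℕ} {x : PathAlgebra k V} :
    x ∈ lengthIdeal k V n ↔ x ∈ lengthSubmodule k V n := Iff.rfl

theorem lengthIdeal_le {n : ℕ} {I : AlgIdeal k (PathAlgebra k V)} :
    lengthIdeal k V n ≤ I ↔ ∀ p : QuiverPath V, n ≤ p.path.length → ofPath k p ∈ I := by
  refine ⟨fun h p hp => h (ofPath_mem_lengthSubmodule hp), fun h => ?_⟩
  have : lengthSubmodule k V n ≤ I.toSubmodule := by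
    rw [lengthSubmodule, Submodule.span_le]
    rintro _ ⟨p, hp, rfl⟩
    exact h p hp
  exact this

theorem lengthIdeal_anti {m n : ℕ} (h : m ≤ n) : lengthIdeal k V n ≤ lengthIdeal k V m :=
  lengthIdeal_le.2 fun _ hp => ofPath_mem_lengthSubmodule (h.trans hp)

theorem ofPath_cons {a b c : V} (p : Quiver.Path a b) (α : b ⟶ c) :
    ofPath k ⟨a, c, p.cons α⟩ = ofPath k ⟨a, b, p⟩ * ofPath k ⟨b, c, α.toPath⟩ := by
  rw [ofPath_mul_ofPath_comp]
  rfl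

theorem arrowIdeal_eq : arrowIdeal k V = lengthIdeal k V 1 := by
  refine le_antisymm (AlgIdeal.gen_le.2 ?_) (lengthIdeal_le.2 ?_)
  · rintro _ ⟨i, j, α, rfl⟩
    exact ofPath_mem_lengthSubmodule le_rfl
  · rintro ⟨a, b, p⟩ hp
    cases p with
    | nil => simp at hp
    | cons p α =>
      rw [ofPath_cons]
      exact AlgIdeal.mul_mem_left _ _ (AlgIdeal.subset_gen (k := k) _ ⟨_, _, α, rfl⟩)

/-- Lengths add under composition, and conversely a path of length `n + 2` factors as its first
arrow followed by a path of length `n + 1`, matching the recursion of `AlgIdeal.pow`. -/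
theorem arrowIdeal_pow (n : ℕ) : (arrowIdeal k V).pow n = lengthIdeal k V n := by
  rw [arrowIdeal_eq]
  match n with
  | 0 =>
    refine le_antisymm (fun x _ => ?_) fun x _ => trivial
    change x ∈ lengthSubmodule k V 0
    rw [lengthSubmodule_zero]
    trivial
  | 1 => rfl
  | n + 2 =>
    have ih := arrowIdeal_pow (n + 1)
    rw [arrowIdeal_eq] at ih
    rw [AlgIdeal.pow, ih]
    refine le_antisymm (AlgIdeal.prod_le.2 fun x hx y hy => ?_) (lengthIdeal_le.2 ?_)
    · have := mul_mem_lengthSubmodule hx hy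
      rwa [show 1 + (n + 1) = n + 2 by omega] at this
    · rintro ⟨a, b, p⟩ hp
      obtain ⟨c, α, q, hq, rfl⟩ := p.eq_toPath_comp_of_length_eq_succ
        (n := p.length - 1) (by simp only at hp; omega)
      rw [← ofPath_mul_ofPath_comp]
      refine AlgIdeal.mul_mem_prod (ofPath_mem_lengthSubmodule le_rfl)
        (ofPath_mem_lengthSubmodule ?_)
      simp only [Quiver.Path.length_comp, Quiver.Path.length_toPath] at hp ⊢
      omega

end PathAlgebra

/-! ### Radical and lifting from a split surjection onto a power of the field. -/

section SplitCriterion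

variable {k : Type u} {A : Type v} {V : Type w} [Field k] [Ring A] [Algebra k A]

theorem CompleteOrthogonalIdempotents.sum_smul_mul [Fintype V] {e : V → A}
    (he : CompleteOrthogonalIdempotents e) (c d : V → k) :
    (∑ v, c v • e v) * (∑ v, d v • e v) = ∑ v, (c v * d v) • e v := by
  classical
  rw [Finset.sum_mul_sum]
  refine Finset.sum_congr rfl fun a _ => ?_
  rw [Finset.sum_eq_single a]
  · rw [smul_mul_smul_comm, he.idem a]
  · intro b _ hb
    rw [smul_mul_smul_comm, he.ortho hb.symm, smul_zero]
  · simp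

/-- The homomorphism from a power of the base field given by orthogonal idempotents. -/
noncomputable def CompleteOrthogonalIdempotents.toNonUnitalAlgHom (k : Type u) [Field k]
    [Algebra k A] [Fintype V] {e : V → A} (he : CompleteOrthogonalIdempotents e) :
    (V → k) →ₙₐ[k] A where
  toFun c := ∑ v, c v • e v
  map_smul' c x := by simp [Finset.smul_sum, mul_smul]
  map_zero' := by simp
  map_add' x y := by simp [add_smul, Finset.sum_add_distrib]
  map_mul' x y := (he.sum_smul_mul x y).symm

theorem CompleteOrthogonalIdempotents.toNonUnitalAlgHom_apply [Fintype V] {e : V → A}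
    (he : CompleteOrthogonalIdempotents e) (c : V → k) :
    he.toNonUnitalAlgHom k c = ∑ v, c v • e v := rfl

theorem mem_jacobsonRadical {x : A} :
    x ∈ jacobsonRadical k A ↔ ∀ a : A, IsUnit (1 + a * x) :=
  forall_congr' fun _ => isQuasiregular_iff_isUnit

theorem jacobsonRadical_eq_ker (g : A →ₙₐ[k] (V → k)) (hg : Function.Surjective g)
    (hnil : ∀ x, g x = 0 → IsNilpotent x) : jacobsonRadical k A = AlgIdeal.ker g := by
  classical
  refine le_antisymm (fun x hx => ?_) fun x hx => ?_
  · rw [AlgIdeal.mem_ker]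
    funext v
    by_contra hv
    -- With this value of `g a`, the `v` component of `g (a * x)` is `-1`, which is not
    -- quasi-regular.
    obtain ⟨a, ha⟩ := hg (Pi.single v (-(g x v)⁻¹))
    -- Quasi-regularity passes through the homomorphism `g`, which is not assumed to preserve
    -- unities.
    have h1 : IsQuasiregular (g (a * x) v) :=
      ((hx a).map g).map (Pi.evalRingHom (fun _ : V => k) v)
    rw [isQuasiregular_iff_isUnit, map_mul, ha, Pi.mul_apply, Pi.single_eq_same, neg_mul,
      inv_mul_cancel₀ hv, add_neg_cancel] at h1
    exact not_isUnit_zero h1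
  · rw [AlgIdeal.mem_ker] at hx
    rw [mem_jacobsonRadical]
    intro a
    exact (hnil _ (by rw [map_mul, hx, mul_zero])).isUnit_one_add

/-- An algebra with a split surjection onto a power of the base field, with nil kernel, is
elementary and can be lifted. -/
theorem isElementary_and_canBeLifted_of_split [Module.Finite k A] [Finite V] [Nonempty V]
    (g : A →ₙₐ[k] (V → k)) (s : (V → k) →ₙₐ[k] A) (hgs : ∀ c, g (s c) = c)
    (hnil : ∀ x, g x = 0 → IsNilpotent x) : IsElementary k A ∧ CanBeLifted k A := by
  have hg : Function.Surjective g := fun c => ⟨s c, hgs c⟩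
  have hrad := jacobsonRadical_eq_ker g hg hnil
  refine ⟨⟨inferInstance, ⟨1, fun x => ⟨one_mul x, mul_one x⟩⟩, Nat.card V, Nat.card_pos, ?_⟩, ?_⟩
  · refine (AlgIdeal.quot_isomorphic _ g hg hrad).trans ?_
    let E := AlgEquiv.piCongrLeft' k (fun _ : V => k) (Finite.equivFin V)
    exact ⟨(E : (V → k) →ₐ[k] (Fin (Nat.card V) → k)), E.bijective⟩
  · refine ⟨NonUnitalAlgHom.range s, ?_⟩
    rw [hrad]
    constructor
    · rw [Submodule.disjoint_def]
      rintro _ ⟨c, rfl⟩ hc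
      have hc' : g (s c) = 0 := hc
      rw [hgs] at hc'
      subst hc'
      exact map_zero s
    · rw [codisjoint_iff, eq_top_iff]
      intro x _
      refine Submodule.mem_sup.2 ⟨s (g x), ⟨g x, rfl⟩, x - s (g x), ?_, add_sub_cancel _ _⟩
      change g (x - s (g x)) = 0
      rw [map_sub, hgs, sub_self]

end SplitCriterion

/-! ### Evaluation homomorphisms out of the path algebra. -/

namespace PathAlgebra

section Eval

variable {k : Type u} {A : Type v} {V : Type w} [Field k] [Ring A] [Algebra k A] [Quiver.{w'} V]

/-- The product of the values of the arrows of a path. -/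
def pathValue (e : V → A) (x : ∀ a b : V, (a ⟶ b) → A) {a : V} : {b : V} → Quiver.Path a b → A
  | _, .nil => e a
  | _, .cons p α => pathValue e x p * x _ _ α

variable {e : V → A} {x : ∀ a b : V, (a ⟶ b) → A}

theorem pathValue_mul_idem (he : OrthogonalIdempotents e) (hr : ∀ a b α, x a b α * e b = x a b α)
    {a b : V} (p : Quiver.Path a b) : pathValue e x p * e b = pathValue e x p := by
  cases p with
  | nil => exact he.idem a
  | cons p α => rw [pathValue, mul_assoc, hr]

theorem idem_mul_pathValue (he : OrthogonalIdempotents e) {a b : V} (p : Quiver.Path a b) :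
    e a * pathValue e x p = pathValue e x p := by
  induction p with
  | nil => exact he.idem a
  | cons p α ih => rw [pathValue, ← mul_assoc, ih]

theorem pathValue_comp (he : OrthogonalIdempotents e) (hr : ∀ a b α, x a b α * e b = x a b α)
    {a b c : V} (p : Quiver.Path a b) (q : Quiver.Path b c) :
    pathValue e x (p.comp q) = pathValue e x p * pathValue e x q := by
  induction q with
  | nil => rw [Quiver.Path.comp_nil, pathValue, pathValue_mul_idem he hr]
  | cons q α ih => rw [Quiver.Path.comp_cons, pathValue, ih, pathValue, mul_assoc]

/-- A path value begins with the idempotent of its source, so `eval` itself asks only for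
compatibility on the right; compatibility on the left identifies the value of a single arrow. -/
theorem pathValue_toPath (hl : ∀ a b α, e a * x a b α = x a b α) {a b : V} (α : a ⟶ b) :
    pathValue e x α.toPath = x a b α := hl a b α

/-- The homomorphism from the path algebra with prescribed values on vertices and arrows. -/
noncomputable def eval (k : Type u) [Field k] [Algebra k A] (he : OrthogonalIdempotents e)
    (hr : ∀ a b α, x a b α * e b = x a b α) : PathAlgebra k V →ₙₐ[k] A :=
  let l : PathAlgebra k V →ₗ[k] A :=
    (pathBasis k V).constr k fun p => pathValue e x p.path
  have hl : ∀ p, l (ofPath k p) = pathValue e x p.path := fun p =>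
    (pathBasis k V).constr_basis k _ p
  have hmul : (LinearMap.compr₂ (mulMap k V) l) = (LinearMap.mul k A).compl₁₂ l l := by
    refine (pathBasis k V).ext fun p => (pathBasis k V).ext fun q => ?_
    simp only [pathBasis_apply, LinearMap.compr₂_apply, LinearMap.compl₁₂_apply,
      LinearMap.mul_apply', ← mul_def, hl]
    by_cases h : p.tgt = q.src
    · obtain ⟨a, b, p⟩ := p
      obtain ⟨c, d, q⟩ := q
      obtain rfl : b = c := h
      rw [ofPath_mul_ofPath_comp, hl, pathValue_comp he hr]
    -- For non-composable paths, insert the idempotents at the target of `p` and the source of `q`;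
    -- they are orthogonal.
    · rw [ofPath_mul_ofPath_of_ne h, map_zero, ← pathValue_mul_idem he hr p.path,
        ← idem_mul_pathValue he q.path, mul_assoc, ← mul_assoc (e p.tgt), he.ortho h, zero_mul,
        mul_zero]
  { toFun := l
    map_smul' := fun c x => map_smul l c x
    map_zero' := map_zero l
    map_add' := fun x y => map_add l x y
    map_mul' := fun x y => congrArg (fun T => T x y) hmul }

theorem eval_ofPath (he : OrthogonalIdempotents e) (hr : ∀ a b α, x a b α * e b = x a b α)
    (p : QuiverPath V) : eval k he hr (ofPath k p) = pathValue e x p.path :=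
  (pathBasis k V).constr_basis k _ p

end Eval

/-! ### Quotients of path algebras are elementary and can be lifted. -/

section Quotient

variable {k : Type u} {V : Type w} [Field k] [Quiver.{w'} V]

/-- The trivial path at a vertex, in the path algebra. -/
noncomputable def vertex (k : Type u) {V : Type w} [Field k] [Quiver.{w'} V] (a : V) :
    PathAlgebra k V :=
  ofPath k ⟨a, a, .nil⟩

theorem linearMap_ext {M : Type*} [AddCommGroup M] [Module k M] {f g : PathAlgebra k V →ₗ[k] M}
    (h : ∀ p, f (ofPath k p) = g (ofPath k p)) : f = g :=
  (pathBasis k V).ext h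

theorem sum_vertex_mul [Fintype V] (x : PathAlgebra k V) : (∑ a, vertex k a) * x = x := by
  have : LinearMap.mulLeft k (∑ a : V, vertex k a) = LinearMap.id := by
    refine linearMap_ext fun ⟨a, b, p⟩ => ?_
    rw [LinearMap.mulLeft_apply, LinearMap.id_apply, Finset.sum_mul, Finset.sum_eq_single a]
    · rw [vertex, ofPath_mul_ofPath_comp, Quiver.Path.nil_comp]
    · exact fun c _ hc => ofPath_mul_ofPath_of_ne hc
    · exact fun h => (h (Finset.mem_univ a)).elim
  exact congrArg (fun T => T x) this

theorem mul_sum_vertex [Fintype V] (x : PathAlgebra k V) : x * (∑ a, vertex k a) = x := by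
  have : LinearMap.mulRight k (∑ a : V, vertex k a) = LinearMap.id := by
    refine linearMap_ext fun ⟨a, b, p⟩ => ?_
    rw [LinearMap.mulRight_apply, LinearMap.id_apply, Finset.mul_sum, Finset.sum_eq_single b]
    · rw [vertex, ofPath_mul_ofPath_comp, Quiver.Path.comp_nil]
    · exact fun c _ hc => ofPath_mul_ofPath_of_ne (Ne.symm hc)
    · exact fun h => (h (Finset.mem_univ b)).elim
  exact congrArg (fun T => T x) this

theorem finite_setOf_length_eq [Finite V] [Finite (Quiver.Total V)] (n : ℕ) :
    {p : QuiverPath V | p.path.length = n}.Finite := by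
  classical
  induction n with
  | zero =>
    refine (Set.finite_range fun a : V => (⟨a, a, .nil⟩ : QuiverPath V)).subset ?_
    rintro ⟨a, b, p⟩ hp
    cases p with
    | nil => exact ⟨a, rfl⟩
    | cons p α => simp at hp
  | succ n ih =>
    let F : QuiverPath V → Quiver.Total V → QuiverPath V := fun p α =>
      if h : p.tgt = α.left then ⟨p.src, α.right, (p.path.cast rfl h).cons α.hom⟩ else p
    refine (Set.Finite.image2 F ih (Set.finite_univ (α := Quiver.Total V))).subset ?_
    rintro ⟨a, b, p⟩ hp
    cases p with
    | nil => simp at hp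
    | @cons c _ p α =>
      refine ⟨⟨a, c, p⟩, ?_, ⟨c, b, α⟩, trivial, ?_⟩
      · simpa using hp
      · simp [F]

theorem finite_setOf_length_lt [Finite V] [Finite (Quiver.Total V)] (n : ℕ) :
    {p : QuiverPath V | p.path.length < n}.Finite := by
  have : {p : QuiverPath V | p.path.length < n} =
      ⋃ m ∈ Set.Iio n, {p : QuiverPath V | p.path.length = m} := by
    ext p
    simp
  rw [this]
  exact (Set.finite_Iio n).biUnion fun m _ => finite_setOf_length_eq m

/-- The homomorphism reading off the coefficients of the trivial paths. -/
noncomputable def augmentation (k : Type u) (V : Type w) [Field k] [Quiver.{w'} V] [Finite V] :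
    PathAlgebra k V →ₙₐ[k] (V → k) :=
  open Classical in
  let := Fintype.ofFinite V
  eval (e := fun a : V => Pi.single a (1 : k)) (x := fun _ _ _ => 0) k
    (CompleteOrthogonalIdempotents.single fun _ : V => k).toOrthogonalIdempotents
    fun _ _ _ => zero_mul _

theorem augmentation_vertex [Finite V] [DecidableEq V] (a : V) :
    augmentation k V (vertex k a) = Pi.single a 1 := by
  rw [augmentation, vertex, eval_ofPath, pathValue]
  congr!

theorem augmentation_ofPath_of_length_pos [Finite V] {p : QuiverPath V} (h : 0 < p.path.length) :
    augmentation k V (ofPath k p) = 0 := by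
  rw [augmentation, eval_ofPath]
  obtain ⟨a, b, p⟩ := p
  cases p with
  | nil => simp at h
  | cons p α => exact mul_zero _

theorem augmentation_apply [Finite V] (x : PathAlgebra k V) (a : V) :
    augmentation k V x a = coeff ⟨a, a, .nil⟩ x := by
  classical
  have : (LinearMap.proj a : (V → k) →ₗ[k] k) ∘ₗ
      ((augmentation k V : PathAlgebra k V →ₙₐ[k] (V → k)) : PathAlgebra k V →ₗ[k] (V → k)) =
      coeff ⟨a, a, .nil⟩ := by
    refine linearMap_ext fun ⟨b, c, p⟩ => ?_
    rw [coeff_ofPath]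
    change augmentation k V (ofPath k _) a = _
    cases p with
    | nil =>
      change augmentation k V (vertex k b) a = _
      rw [augmentation_vertex, Pi.single_apply]
      refine if_congr ⟨fun h => by subst h; rfl, fun h => (congrArg QuiverPath.src h).symm⟩ rfl rfl
    | cons p α =>
      rw [augmentation_ofPath_of_length_pos (by simp), if_neg, Pi.zero_apply]
      intro h
      simpa using congrArg (fun q : QuiverPath V => q.path.length) h
  exact congrArg (fun T => T x) this

theorem augmentation_eq_zero_iff [Finite V] {x : PathAlgebra k V} :
    augmentation k V x = 0 ↔ x ∈ lengthIdeal k V 1 := by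
  rw [mem_lengthIdeal, mem_lengthSubmodule_iff]
  constructor
  · rintro h ⟨a, b, p⟩ hp
    cases p with
    | nil => rw [← augmentation_apply, h, Pi.zero_apply]
    | cons p α => simp at hp
  · intro h
    funext a
    rw [augmentation_apply]
    exact h _ (by simp)

variable {A : Type v} [Ring A] [Algebra k A]

/-- The path algebra carries no unity here, so powers are formed in `A` and followed by a preimage
deep in the filtration. This gives nilpotency of the image of `J`. -/
theorem exists_apply_eq_pow (π : PathAlgebra k V →ₙₐ[k] A) {x : PathAlgebra k V}
    (hx : x ∈ lengthIdeal k V 1) (n : ℕ) :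
    ∃ y ∈ lengthIdeal k V (n + 1), π y = π x ^ (n + 1) := by
  induction n with
  | zero => exact ⟨x, hx, by simp⟩
  | succ n ih =>
    obtain ⟨y, hy, h⟩ := ih
    exact ⟨y * x, mul_mem_lengthSubmodule hy hx, by rw [map_mul, h, ← pow_succ]⟩

/-- Paths of length at least `t` die, and a finite quiver has only finitely many shorter ones. -/
theorem finite_of_surjective [Finite V] [Finite (Quiver.Total V)] {B : Type v} [NonUnitalRing B]
    [Module k B] (π : PathAlgebra k V →ₙₐ[k] B)
    (hπ : Function.Surjective π) {t : ℕ} (ht : lengthIdeal k V t ≤ AlgIdeal.ker π) :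
    Module.Finite k B := by
  refine ⟨Submodule.fg_def.2
    ⟨(fun p => π (ofPath k p)) '' {p | p.path.length < t}, (finite_setOf_length_lt t).image _, ?_⟩⟩
  rw [eq_top_iff]
  rintro y -
  obtain ⟨x, rfl⟩ := hπ y
  have hx : x ∈ Submodule.span k (Set.range (pathBasis k V)) := by
    rw [(pathBasis k V).span_eq]
    trivial
  induction hx using Submodule.span_induction with
  | zero => rw [map_zero]; exact zero_mem _
  | add a b _ _ ha hb => rw [map_add]; exact add_mem ha hb
  | smul c a _ ha => rw [map_smul]; exact Submodule.smul_mem _ c ha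
  | mem x hx =>
    obtain ⟨p, rfl⟩ := hx
    by_cases h : p.path.length < t
    · exact Submodule.subset_span ⟨p, h, rfl⟩
    · have : π (pathBasis k V p) = 0 := lengthIdeal_le.1 ht p (not_lt.1 h)
      rw [this]
      exact zero_mem _

/-- A quotient of the path algebra of a finite quiver by an ideal between a power of the arrow
ideal and the arrow ideal is elementary and can be lifted. -/
theorem isElementary_and_canBeLifted_of_surjective [Finite V] [Nonempty V]
    [Finite (Quiver.Total V)] (π : PathAlgebra k V →ₙₐ[k] A) (hπ : Function.Surjective π) {t : ℕ}
    (ht : lengthIdeal k V t ≤ AlgIdeal.ker π) (h1 : AlgIdeal.ker π ≤ lengthIdeal k V 1) :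
    IsElementary k A ∧ CanBeLifted k A := by
  classical
  let := Fintype.ofFinite V
  have hfin := finite_of_surjective π hπ ht
  -- `π` need not be unital by definition; surjectivity forces the image of a left identity to be
  -- `1`.
  have hone : ∑ a, π (vertex k a) = 1 := by
    rw [← map_sum]
    obtain ⟨x, hx⟩ := hπ 1
    rw [← mul_one (π _), ← hx, ← map_mul, sum_vertex_mul]
  have he : CompleteOrthogonalIdempotents fun a : V => π (vertex k a) := by
    refine ⟨⟨fun a => ?_, fun a b hab => ?_⟩, hone⟩
    · rw [IsIdempotentElem, ← map_mul, vertex, ofPath_mul_ofPath_comp, Quiver.Path.comp_nil]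
    · change π (vertex k a) * π (vertex k b) = 0
      rw [← map_mul, vertex, vertex, ofPath_mul_ofPath_of_ne hab, map_zero]
  let σ := Function.surjInv hπ
  have hσ : ∀ y, π (σ y) = y := Function.surjInv_eq hπ
  have haug : ∀ x y : PathAlgebra k V, π x = π y → augmentation k V x = augmentation k V y := by
    intro x y h
    rw [← sub_eq_zero, ← map_sub, augmentation_eq_zero_iff]
    apply h1
    rw [AlgIdeal.mem_ker, map_sub, h, sub_self]
  -- The augmentation descends along `π`: by `haug` the choice of preimage `σ y` is immaterial.
  let g : A →ₙₐ[k] (V → k) :=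
    { toFun := fun y => augmentation k V (σ y)
      map_smul' := fun c y => by
        refine (haug _ (c • σ y) ?_).trans (map_smul _ c (σ y))
        rw [hσ, map_smul, hσ]
      map_zero' := (haug _ 0 (by rw [hσ, map_zero])).trans (map_zero _)
      map_add' := fun y z => by
        rw [← map_add]
        exact haug _ _ (by rw [hσ, map_add, hσ, hσ])
      map_mul' := fun y z => by
        rw [← map_mul]
        exact haug _ _ (by rw [hσ, map_mul, hσ, hσ]) }
  have hg : ∀ x, g (π x) = augmentation k V x := fun x => haug _ _ (hσ _)
  refine isElementary_and_canBeLifted_of_split g (he.toNonUnitalAlgHom k) (fun c => ?_)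
    fun y hy => ?_
  · simp only [he.toNonUnitalAlgHom_apply, map_sum, map_smul, hg, augmentation_vertex]
    funext a
    simp [Finset.sum_apply, Pi.single_apply]
  · obtain ⟨x, rfl⟩ := hπ y
    rw [hg, augmentation_eq_zero_iff] at hy
    obtain ⟨y, hy, h⟩ := exists_apply_eq_pow π hy t
    exact ⟨t + 1, h ▸ ht (lengthIdeal_anti t.le_succ hy)⟩

end Quotient

end PathAlgebra

/-! ### Nilpotency of the radical, lifted idempotents, and generation modulo the square. -/

section Radical

variable {k : Type u} {A : Type v} [Field k] [Ring A] [Algebra k A]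

theorem jacobsonRadical_le_jacobson {x : A} (hx : x ∈ jacobsonRadical k A) :
    x ∈ Ring.jacobson A := by
  rw [← Ideal.jacobson_bot, Ideal.mem_jacobson_iff]
  intro y
  obtain ⟨u, hu⟩ := mem_jacobsonRadical.1 hx y
  refine ⟨↑u⁻¹, ?_⟩
  have : (↑u⁻¹ : A) * y * x + ↑u⁻¹ = ↑u⁻¹ * (1 + y * x) := by noncomm_ring
  rw [this, ← hu, Units.inv_mul, sub_self]
  exact zero_mem _

/-- A finite-dimensional algebra is Artinian, so its Jacobson radical is nilpotent. -/
theorem exists_jacobsonRadical_pow_eq_bot [Module.Finite k A] :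
    ∃ t : ℕ, (jacobsonRadical k A).toSubmodule ^ t = ⊥ := by
  have : IsArtinianRing A := IsArtinianRing.of_finite k A
  obtain ⟨t, ht⟩ := IsSemiprimaryRing.isNilpotent (R := A)
  have hle : (jacobsonRadical k A).toSubmodule ≤ (Ring.jacobson A).restrictScalars k :=
    fun _ hx => jacobsonRadical_le_jacobson hx
  -- The exponent must be positive: the zeroth power is the scalars for subspaces, but the whole
  -- ring for ideals.
  refine ⟨t + 1, eq_bot_iff.2 fun x hx => ?_⟩
  have hx' := pow_le_pow_left' hle (t + 1) hx
  rw [← Submodule.restrictScalars_pow t.succ_ne_zero, Submodule.restrictScalars_mem,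
    Submodule.pow_succ, ht, zero_mul] at hx'
  exact hx'

theorem isNilpotent_of_mem_jacobsonRadical [Module.Finite k A] {x : A}
    (hx : x ∈ jacobsonRadical k A) : IsNilpotent x := by
  obtain ⟨t, ht⟩ := exists_jacobsonRadical_pow_eq_bot (k := k) (A := A)
  refine ⟨t, ?_⟩
  have : x ^ t ∈ (jacobsonRadical k A).toSubmodule ^ t := Submodule.pow_mem_pow _ hx t
  rw [ht] at this
  exact this

/-- In a lifted elementary algebra the radical is complemented by the span of a complete system of
orthogonal idempotents. -/
theorem IsElementary.exists_idempotents (h : IsElementary k A) (hl : CanBeLifted k A) :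
    ∃ n : ℕ, 0 < n ∧ ∃ (g : A →ₙₐ[k] (Fin n → k)) (e : Fin n → A),
      CompleteOrthogonalIdempotents e ∧ (∀ i, g (e i) = Pi.single i 1) ∧
      jacobsonRadical k A = AlgIdeal.ker g := by
  have := h.finiteDimensional
  obtain ⟨n, hn, φ, hφ⟩ := h.quotient_iso
  obtain ⟨B, hB⟩ := hl
  let g : A →ₙₐ[k] (Fin n → k) := φ.comp (jacobsonRadical k A).projHom
  have hg : Function.Surjective g := hφ.surjective.comp (AlgIdeal.projHom_surjective _)
  have hker : ∀ x, g x = 0 ↔ x ∈ jacobsonRadical k A := fun x => by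
    rw [← AlgIdeal.projHom_eq_zero, ← map_eq_zero_iff φ hφ.injective]
    rfl
  have hBsurj : ∀ c, ∃ b ∈ B, g b = c := by
    intro c
    obtain ⟨y, rfl⟩ := hg c
    obtain ⟨b, hb, r, hr, rfl⟩ := Submodule.mem_sup.1
      (hB.codisjoint.eq_top.ge (Submodule.mem_top (x := y)))
    exact ⟨b, hb, by rw [map_add, (hker r).2 hr, add_zero]⟩
  have hBinj : ∀ b ∈ B, ∀ b' ∈ B, g b = g b' → b = b' := by
    intro b hb b' hb' hbb
    rw [← sub_eq_zero]
    refine (Submodule.disjoint_def.1 hB.disjoint) _ (sub_mem hb hb') ?_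
    exact (hker _).1 (by rw [map_sub, hbb, sub_self])
  -- `s` inverts the bijection `B → k^n` given by `g`; injectivity on `B` makes it multiplicative.
  choose s hsB hs using hBsurj
  have hsmul : ∀ c d, s c * s d = s (c * d) := fun c d =>
    hBinj _ (mul_mem (hsB c) (hsB d)) _ (hsB _) (by rw [map_mul, hs, hs, hs])
  have hszero : s 0 = 0 := hBinj _ (hsB 0) _ (zero_mem B) (by rw [hs, map_zero])
  have hsum : ∑ i, s (Pi.single i 1) = s 1 := by
    refine hBinj _ (sum_mem fun i _ => hsB _) _ (hsB 1) ?_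
    rw [map_sum, hs]
    simp only [hs]
    exact Finset.univ_sum_single (1 : Fin n → k)
  -- `B` is not assumed unital: `1 - s 1` is an idempotent in the radical, hence nilpotent, hence
  -- zero.
  have hone : s 1 = 1 := by
    have hidem : IsIdempotentElem (1 - s 1) := by
      refine IsIdempotentElem.one_sub ?_
      rw [IsIdempotentElem, hsmul, one_mul]
    have h1 : g 1 = 1 := by
      obtain ⟨y, hy⟩ := hg 1
      rw [← mul_one (g 1), ← hy, ← map_mul, one_mul]
    have hnil : IsNilpotent (1 - s 1) :=
      isNilpotent_of_mem_jacobsonRadical ((hker _).1 (by rw [map_sub, h1, hs, sub_self]))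
    exact (sub_eq_zero.1 (hidem.eq_zero_of_isNilpotent hnil)).symm
  refine ⟨n, hn, g, fun i => s (Pi.single i 1), ⟨⟨fun i => ?_, fun i j hij => ?_⟩, ?_⟩,
    fun i => hs _, ?_⟩
  · rw [IsIdempotentElem, hsmul, ← Pi.single_mul, one_mul]
  · change s _ * s _ = 0
    rw [hsmul, show (Pi.single i (1 : k) : Fin n → k) * Pi.single j 1 = 0 by
      funext l; by_cases h : l = i <;> simp [Pi.single_apply, h, hij], hszero]
  · rw [hsum, hone]
  · exact SetLike.ext fun x => (hker x).symm

/-- A subspace has a basis modulo another one. -/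
theorem Submodule.exists_basis_modulo {M : Type v} [AddCommGroup M] [Module k M]
    [Module.Finite k M] (N P : Submodule k M) :
    ∃ (d : ℕ) (x : Fin d → M), (∀ i, x i ∈ N) ∧
      (∀ c : Fin d → k, ∑ i, c i • x i ∈ P → c = 0) ∧ N ≤ Submodule.span k (Set.range x) ⊔ P := by
  obtain ⟨Q, hQ⟩ := exists_isCompl (N ⊓ P)
  -- By the modular law this is a complement of `N ⊓ P` inside `N`; its basis is the required one.
  let C := Q ⊓ N
  have hC : N ⊓ P ⊔ C = N := by
    rw [← sup_inf_assoc_of_le Q (inf_le_left : N ⊓ P ≤ N), hQ.sup_eq_top, top_inf_eq]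
  let b := Module.finBasis k C
  refine ⟨_, fun i => (b i : M), fun i => (b i).2.2, fun c hc => ?_, ?_⟩
  · have hsum : ∑ i, c i • (b i : M) = ((∑ i, c i • b i : C) : M) := by simp
    have h0 : ((∑ i, c i • b i : C) : M) = 0 := by
      refine Submodule.disjoint_def.1 hQ.disjoint _ ⟨(∑ i, c i • b i : C).2.2, ?_⟩
        (∑ i, c i • b i : C).2.1
      rw [← hsum]
      exact hc
    rw [ZeroMemClass.coe_eq_zero] at h0
    funext i
    exact Fintype.linearIndependent_iff.1 b.linearIndependent c h0 i
  · have hspan : Submodule.span k (Set.range fun i => (b i : M)) = C := by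
      rw [Set.range_comp' (fun x : C => (x : M)) b]
      change Submodule.span k (C.subtype '' _) = C
      rw [Submodule.span_image, b.span_eq, Submodule.map_top, Submodule.range_subtype]
    rw [hspan]
    conv_lhs => rw [← hC]
    rw [sup_comm]
    exact sup_le_sup_left inf_le_right _

/-- A Nakayama argument for a subspace closed under multiplication: the error term `R ^ 2` is pushed
into ever higher powers of `R`, until it vanishes. -/
theorem Submodule.le_of_le_sup_sq {S R : Submodule k A} (hS : S * S ≤ S) (hRR : R ^ 2 ≤ R)
    (hR : R ≤ S ⊔ R ^ 2) {t : ℕ} (ht : R ^ t = ⊥) : R ≤ S := by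
  -- A factor from `S ⊓ R` keeps products with `S` in `S` and also raises the power of `R` in the
  -- error term; `S` alone would not do the latter.
  have hT : R ≤ (S ⊓ R) ⊔ R ^ 2 := by
    rw [sup_comm, ← sup_inf_assoc_of_le S hRR, sup_comm]
    exact le_inf hR le_rfl
  have hstep : ∀ n : ℕ, R ^ (n + 1) ≤ S ⊔ R ^ (n + 2) := by
    intro n
    induction n with
    | zero => simpa using hR
    | succ n ih =>
      calc R ^ (n + 1 + 1) = R * R ^ (n + 1) := pow_succ' _ _
        _ ≤ (S ⊓ R ⊔ R ^ 2) * R ^ (n + 1) := mul_le_mul' hT le_rfl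
        _ = (S ⊓ R) * R ^ (n + 1) ⊔ R ^ (n + 1 + 2) := by
          rw [Submodule.sup_mul, ← pow_add, add_comm 2]
        _ ≤ (S ⊓ R) * (S ⊔ R ^ (n + 2)) ⊔ R ^ (n + 1 + 2) :=
          sup_le_sup_right (mul_le_mul' le_rfl ih) _
        _ ≤ S ⊔ R ^ (n + 1 + 2) := by
          rw [Submodule.mul_sup]
          refine sup_le (sup_le ?_ ?_) le_sup_right
          · exact ((mul_le_mul' inf_le_left le_rfl).trans hS).trans le_sup_left
          · refine (mul_le_mul' inf_le_right le_rfl).trans ?_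
            rw [← pow_succ']
            exact le_sup_right
  have hall : ∀ n : ℕ, R ≤ S ⊔ R ^ (n + 1) := by
    intro n
    induction n with
    | zero => simp
    | succ n ih => exact ih.trans (sup_le le_sup_left (hstep n))
  have := hall t
  rwa [pow_succ, ht, Submodule.bot_mul, sup_bot_eq] at this

end Radical

/-! ### Peirce corners and evaluation on a quiver with arrows in the radical. -/

section Presentation

variable {k : Type u} {A : Type v} {V : Type w} [Field k] [Ring A] [Algebra k A]

/-- The elements of an ideal in the corner given by two idempotents. -/
def AlgIdeal.corner (R : AlgIdeal k A) (e f : A) : Submodule k A where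
  carrier := {x | x ∈ R ∧ e * x = x ∧ x * f = x}
  add_mem' := by
    rintro x y ⟨hx, hx1, hx2⟩ ⟨hy, hy1, hy2⟩
    exact ⟨R.add_mem hx hy, by rw [mul_add, hx1, hy1], by rw [add_mul, hx2, hy2]⟩
  zero_mem' := ⟨R.zero_mem, mul_zero e, zero_mul f⟩
  smul_mem' := by
    rintro c x ⟨hx, hx1, hx2⟩
    exact ⟨R.smul_mem c hx, by rw [mul_smul_comm, hx1], by rw [smul_mul_assoc, hx2]⟩

theorem AlgIdeal.mem_corner {R : AlgIdeal k A} {e f x : A} :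
    x ∈ R.corner e f ↔ x ∈ R ∧ e * x = x ∧ x * f = x := Iff.rfl

theorem AlgIdeal.mul_mul_mem_corner {R : AlgIdeal k A} {e f x : A} (he : IsIdempotentElem e)
    (hf : IsIdempotentElem f) (hx : x ∈ R) : e * x * f ∈ R.corner e f :=
  ⟨R.mul_mem_right f (R.mul_mem_left e hx), by rw [← mul_assoc, ← mul_assoc, he.eq],
    by rw [mul_assoc, hf.eq]⟩

theorem AlgIdeal.toSubmodule_sq_le (R : AlgIdeal k A) : R.toSubmodule ^ 2 ≤ R.toSubmodule := by
  rw [pow_two, Submodule.mul_le]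
  exact fun x _ y hy => R.mul_mem_left x hy

end Presentation

namespace PathAlgebra

variable {k : Type u} {A : Type v} {V : Type w} [Field k] [Ring A] [Algebra k A] [Quiver.{w'} V]
  {e : V → A} {x : ∀ a b : V, (a ⟶ b) → A} {R : AlgIdeal k A}

/-- Exponents are positive because `R ^ 0` consists of scalars, where vertex idempotents need not
lie. -/
theorem pathValue_mem_pow (hx : ∀ a b α, x a b α ∈ R) {a b : V} (p : Quiver.Path a b) (n : ℕ)
    (h : n + 1 ≤ p.length) : pathValue e x p ∈ R.toSubmodule ^ (n + 1) := by
  induction p generalizing n with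
  | nil => simp at h
  | cons p α ih =>
    rw [pathValue]
    cases n with
    | zero => rw [zero_add, pow_one]; exact R.mul_mem_left _ (hx _ _ α)
    | succ n =>
      rw [pow_succ]
      refine Submodule.mul_mem_mul (ih n ?_) (hx _ _ α)
      rw [Quiver.Path.length_cons] at h
      omega

theorem eval_mem_pow (he : OrthogonalIdempotents e) (hr : ∀ a b α, x a b α * e b = x a b α)
    (hx : ∀ a b α, x a b α ∈ R) (n : ℕ) {z : PathAlgebra k V} (hz : z ∈ lengthIdeal k V (n + 1)) :
    eval k he hr z ∈ R.toSubmodule ^ (n + 1) := by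
  have : lengthSubmodule k V (n + 1) ≤ (R.toSubmodule ^ (n + 1)).comap
      ((eval k he hr : PathAlgebra k V →ₙₐ[k] A) : PathAlgebra k V →ₗ[k] A) := by
    rw [lengthSubmodule, Submodule.span_le]
    rintro _ ⟨p, hp, rfl⟩
    change eval k he hr (ofPath k p) ∈ R.toSubmodule ^ (n + 1)
    rw [eval_ofPath]
    exact pathValue_mem_pow hx p.path n hp
  exact this hz

/-- Both sides kill every nontrivial path and agree on vertices. Hence elements killed by `eval` lie
in `J`. -/
theorem apply_eval [Finite V] (he : OrthogonalIdempotents e)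
    (hr : ∀ a b α, x a b α * e b = x a b α) (g : A →ₙₐ[k] (V → k)) (hx : ∀ a b α, g (x a b α) = 0)
    (hge : ∀ a b, g (e a) b = augmentation k V (vertex k a) b) (z : PathAlgebra k V) :
    g (eval k he hr z) = augmentation k V z := by
  have : ((g.comp (eval k he hr) : PathAlgebra k V →ₙₐ[k] (V → k)) :
      PathAlgebra k V →ₗ[k] (V → k)) =
      ((augmentation k V : PathAlgebra k V →ₙₐ[k] (V → k)) : PathAlgebra k V →ₗ[k] (V → k)) := by
    refine linearMap_ext fun ⟨a, b, p⟩ => ?_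
    change g (eval k he hr (ofPath k _)) = augmentation k V (ofPath k _)
    rw [eval_ofPath]
    cases p with
    | nil => exact funext (hge a)
    | cons p α =>
      rw [augmentation_ofPath_of_length_pos (by simp), pathValue, map_mul, hx, mul_zero]
  exact congrArg (fun T => T z) this

/-- Paths of length at least two land in `R ^ 2`, and the corner kills every arrow that does not run
from `a` to `b`; only the linear part at `(a, b)` survives. -/
theorem corner_eval_sub_mem_sq [∀ a b : V, Fintype (a ⟶ b)] (he : OrthogonalIdempotents e)
    (hx : ∀ a b α, x a b α ∈ R.corner (e a) (e b)) {z : PathAlgebra k V}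
    (hz : z ∈ lengthIdeal k V 1) (a b : V) :
    e a * eval k he (fun a b α => (hx a b α).2.2) z * e b -
      ∑ α : a ⟶ b, coeff ⟨a, b, α.toPath⟩ z • x a b α ∈ R.toSubmodule ^ 2 := by
  classical
  set f := eval k he fun a b α => (hx a b α).2.2 with hf
  let T : PathAlgebra k V →ₗ[k] A :=
    LinearMap.mulRight k (e b) ∘ₗ LinearMap.mulLeft k (e a) ∘ₗ (f : PathAlgebra k V →ₗ[k] A) -
      ∑ α : a ⟶ b, (coeff ⟨a, b, α.toPath⟩).smulRight (x a b α)
  have hT : ∀ z, T z = e a * f z * e b - ∑ α : a ⟶ b, coeff ⟨a, b, α.toPath⟩ z • x a b α := by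
    intro z
    simp [T]
  have : lengthSubmodule k V 1 ≤ (R.toSubmodule ^ 2).comap T := by
    rw [lengthSubmodule, Submodule.span_le]
    rintro _ ⟨⟨c, d, p⟩, hp, rfl⟩
    change T _ ∈ R.toSubmodule ^ 2
    rw [hT, hf, eval_ofPath]
    cases p with
    | nil => simp at hp
    | @cons d' _ q β =>
      cases q with
      | nil =>
        have h0 : pathValue e x (Quiver.Path.nil.cons β) = x c d β := (hx c d β).2.1
        rw [h0]
        by_cases hab : c = a ∧ d = b
        · obtain ⟨rfl, rfl⟩ := hab
          rw [(hx c d β).2.1, (hx c d β).2.2, Finset.sum_eq_single β]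
          · change x c d β - coeff ⟨c, d, β.toPath⟩ (ofPath k ⟨c, d, β.toPath⟩) • x c d β ∈ _
            rw [coeff_ofPath, if_pos rfl, one_smul, sub_self]
            exact zero_mem _
          · intro α _ hα
            rw [coeff_ofPath, if_neg, zero_smul]
            intro h
            simp only [QuiverPath.mk.injEq, heq_eq_eq, true_and, Quiver.Hom.toPath,
              Quiver.Path.cons.injEq] at h
            exact hα h.symm
          · simp
        · rw [Finset.sum_eq_zero, sub_zero]
          · have : e a * x c d β * e b = 0 := by
              rw [← (hx c d β).2.1, ← mul_assoc]
              by_cases hc : c = a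
              · have hd : d ≠ b := fun h => hab ⟨hc, h⟩
                rw [← (hx c d β).2.2, mul_assoc, mul_assoc, mul_assoc (x c d β), he.ortho hd]
                simp
              · rw [he.ortho (Ne.symm hc), zero_mul, zero_mul]
            rw [this]
            exact zero_mem _
          · intro α _
            rw [coeff_ofPath, if_neg, zero_smul]
            intro h
            exact hab ⟨congrArg QuiverPath.src h, congrArg QuiverPath.tgt h⟩
      | cons q γ =>
        rw [Finset.sum_eq_zero, sub_zero]
        · have h2 := pathValue_mem_pow (e := e) (R := R) (fun a b α => (hx a b α).1)
            ((q.cons γ).cons β) 1 (by simp)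
          rw [pow_succ, pow_one] at h2 ⊢
          refine Submodule.mul_induction_on h2 (fun s hs t ht => ?_) fun s t hs ht => ?_
          · rw [← mul_assoc, mul_assoc]
            exact Submodule.mul_mem_mul (R.mul_mem_left _ hs) (R.mul_mem_right _ ht)
          · rw [mul_add, add_mul]
            exact add_mem hs ht
        · intro α _
          rw [coeff_ofPath, if_neg, zero_smul]
          intro h
          simpa using congrArg (fun q : QuiverPath V => q.path.length) h
  have := this hz
  rw [Submodule.mem_comap, hT] at this
  exact this

/-- The augmentation removes the vertex coefficients; independence of the arrows modulo `R ^ 2`,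
corner by corner, removes the arrow coefficients. -/
theorem ker_eval_le [Finite V] [∀ a b : V, Fintype (a ⟶ b)] (he : OrthogonalIdempotents e)
    (hx : ∀ a b α, x a b α ∈ R.corner (e a) (e b)) (g : A →ₙₐ[k] (V → k))
    (hgR : R ≤ AlgIdeal.ker g) (hge : ∀ a b, g (e a) b = augmentation k V (vertex k a) b)
    (hli : ∀ a b (c : (a ⟶ b) → k), ∑ α, c α • x a b α ∈ R.toSubmodule ^ 2 → c = 0) :
    AlgIdeal.ker (eval k he fun a b α => (hx a b α).2.2) ≤ lengthIdeal k V 2 := by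
  intro z hz
  rw [AlgIdeal.mem_ker] at hz
  have h1 : z ∈ lengthIdeal k V 1 := by
    rw [← augmentation_eq_zero_iff, ← apply_eval he (fun a b α => (hx a b α).2.2) g (fun a b α => hgR (hx a b α).1) hge, hz,
      map_zero]
  rw [mem_lengthIdeal, mem_lengthSubmodule_iff]
  rintro ⟨a, b, p⟩ hp
  cases p with
  | nil => exact mem_lengthSubmodule_iff.1 h1 _ (by simp)
  | cons p β =>
    cases p with
    | nil =>
      have h2 := corner_eval_sub_mem_sq he hx h1 a b
      rw [hz, mul_zero, zero_mul, zero_sub, neg_mem_iff] at h2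
      exact congrFun (hli a b _ h2) β
    | cons p γ => simp at hp

theorem eval_surjective [Fintype V] (he : CompleteOrthogonalIdempotents e)
    (hx : ∀ a b α, x a b α ∈ R.corner (e a) (e b))
    (hspan : ∀ a b, R.corner (e a) (e b) ≤
      Submodule.span k (Set.range (x a b)) ⊔ R.toSubmodule ^ 2)
    {t : ℕ} (ht : R.toSubmodule ^ t = ⊥) (hR : ∀ y : A, ∃ c : V → k, y - ∑ a, c a • e a ∈ R) :
    Function.Surjective (eval k he.toOrthogonalIdempotents fun a b α => (hx a b α).2.2) := by
  set f := eval k he.toOrthogonalIdempotents fun a b α => (hx a b α).2.2 with hf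
  let S : Submodule k A := LinearMap.range (f : PathAlgebra k V →ₗ[k] A)
  have hS : ∀ z, f z ∈ S := fun z => ⟨z, rfl⟩
  have hSS : S * S ≤ S := by
    rw [Submodule.mul_le]
    rintro _ ⟨y, rfl⟩ _ ⟨z, rfl⟩
    exact ⟨y * z, map_mul f y z⟩
  have hvertex : ∀ a, e a ∈ S := fun a => by
    have := hS (vertex k a)
    rw [hf, vertex, eval_ofPath] at this
    exact this
  have harrow : ∀ a b α, x a b α ∈ S := fun a b α => by
    have := hS (ofPath k ⟨a, b, α.toPath⟩)
    rw [hf, eval_ofPath, pathValue_toPath fun a b α => (hx a b α).2.1] at this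
    exact this
  have hle : R.toSubmodule ≤ S ⊔ R.toSubmodule ^ 2 := by
    intro y hy
    -- Peirce decomposition: generators modulo `R ^ 2` are only known corner by corner.
    have : y = ∑ a, ∑ b, e a * y * e b := by
      simp only [← Finset.mul_sum, ← Finset.sum_mul, he.complete, one_mul, mul_one]
    rw [this]
    refine sum_mem fun a _ => sum_mem fun b _ => ?_
    refine sup_le_sup_right (?_ : Submodule.span k (Set.range (x a b)) ≤ S) _
      (hspan a b (AlgIdeal.mul_mul_mem_corner (he.idem a) (he.idem b) hy))
    rw [Submodule.span_le]
    rintro _ ⟨α, rfl⟩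
    exact harrow a b α
  have hRS := Submodule.le_of_le_sup_sq hSS R.toSubmodule_sq_le hle ht
  intro y
  obtain ⟨c, hc⟩ := hR y
  have : y ∈ S := by
    rw [← sub_add_cancel y (∑ a, c a • e a)]
    exact add_mem (hRS hc) (sum_mem fun a _ => S.smul_mem _ (hvertex a))
  exact this

end PathAlgebra

/-! ### The quiver of a lifted elementary algebra, and the equivalence. -/

theorem exists_pathAlgebra_presentation {k : Type u} {A : Type v} [Field k] [Ring A] [Algebra k A]
    (h : IsElementary k A) (hl : CanBeLifted k A) :
    ∃ (V : Type w) (_ : Quiver.{w'} V),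
      Nonempty V ∧ Finite V ∧ Finite (Quiver.Total V) ∧
      ∃ f : PathAlgebra k V →ₙₐ[k] A, Function.Surjective f ∧
        (∃ t : ℕ, PathAlgebra.lengthIdeal k V t ≤ AlgIdeal.ker f) ∧
        AlgIdeal.ker f ≤ PathAlgebra.lengthIdeal k V 2 := by
  classical
  have := h.finiteDimensional
  obtain ⟨n, hn, g₀, e₀, he₀, hge₀, hrad⟩ := h.exists_idempotents hl
  let V := ULift.{w} (Fin n)
  let e : V → A := fun a => e₀ a.down
  have he : CompleteOrthogonalIdempotents e := (CompleteOrthogonalIdempotents.equiv Equiv.ulift).2 he₀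
  let g : A →ₙₐ[k] (V → k) :=
    ((AlgEquiv.piCongrLeft' k (fun _ : Fin n => k) Equiv.ulift.{w}.symm :
      (Fin n → k) →ₐ[k] (V → k)) : (Fin n → k) →ₙₐ[k] (V → k)).comp g₀
  have hg : ∀ y a, g y a = g₀ y a.down := fun _ _ => rfl
  let R := jacobsonRadical k A
  have hgR : ∀ y, g y = 0 ↔ y ∈ R := fun y => by
    rw [show R = AlgIdeal.ker g₀ from hrad, AlgIdeal.mem_ker]
    exact ⟨fun h => funext fun i => congrFun h ⟨i⟩, fun h => funext fun i => congrFun h i.down⟩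
  obtain ⟨t, ht⟩ := exists_jacobsonRadical_pow_eq_bot (k := k) (A := A)
  -- The number `d a b` of arrows is the dimension of the corner modulo its intersection with `R ^
  -- 2`.
  choose d x₀ hx₀ hli₀ hspan₀ using fun a b : V =>
    Submodule.exists_basis_modulo (R.corner (e a) (e b)) (R.toSubmodule ^ 2)
  let : Quiver.{w'} V := ⟨fun a b => ULift.{w'} (Fin (d a b))⟩
  let (a b : V) : Fintype (a ⟶ b) := inferInstanceAs (Fintype (ULift (Fin (d a b))))
  let x : ∀ a b : V, (a ⟶ b) → A := fun a b α => x₀ a b (ULift.down α)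
  have hx : ∀ a b α, x a b α ∈ R.corner (e a) (e b) := fun a b α => hx₀ a b _
  have hge : ∀ a b, g (e a) b = PathAlgebra.augmentation k V (PathAlgebra.vertex k a) b := by
    intro a b
    rw [hg, hge₀, PathAlgebra.augmentation_vertex]
    simp only [Pi.single_apply, ULift.down_inj]
  have hfin : Finite (Quiver.Total V) :=
    Finite.of_surjective (fun p : Σ a b : V, (a ⟶ b) => (⟨p.1, p.2.1, p.2.2⟩ : Quiver.Total V))
      fun α => ⟨⟨α.left, α.right, α.hom⟩, rfl⟩
  refine ⟨V, inferInstance, ⟨⟨⟨0, hn⟩⟩⟩, inferInstance, hfin,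
    PathAlgebra.eval k he.toOrthogonalIdempotents fun a b α => (hx a b α).2.2, ?_, ⟨t + 1, ?_⟩, ?_⟩
  · refine PathAlgebra.eval_surjective he hx (fun a b => ?_) ht fun y => ⟨g y, ?_⟩
    · refine (hspan₀ a b).trans (sup_le_sup_right (Submodule.span_mono ?_) _)
      rintro _ ⟨i, rfl⟩
      exact ⟨ULift.up i, rfl⟩
    · rw [← hgR, map_sub, sub_eq_zero]
      funext b
      simp only [map_sum, map_smul, Finset.sum_apply, Pi.smul_apply, hge,
        PathAlgebra.augmentation_vertex, smul_eq_mul]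
      rw [Finset.sum_eq_single b]
      · rw [Pi.single_eq_same, mul_one]
      · intro a _ hab
        rw [Pi.single_eq_of_ne hab.symm, mul_zero]
      · simp
  · intro z hz
    have := PathAlgebra.eval_mem_pow he.toOrthogonalIdempotents (fun a b α => (hx a b α).2.2)
      (R := R) (fun a b α => (hx a b α).1) t hz
    rw [pow_succ, ht, Submodule.bot_mul] at this
    exact this
  · refine PathAlgebra.ker_eval_le he.toOrthogonalIdempotents hx g (fun y hy => (hgR y).2 hy) hge
      fun a b c hc => ?_
    have : (fun i => c (ULift.up i)) = 0 := by
      refine hli₀ a b _ ?_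
      convert hc using 1
      exact Fintype.sum_equiv Equiv.ulift.symm _ _ fun _ => rfl
    funext α
    exact congrFun this α.down

theorem corollary3p16 {k : Type u} {Λ : Type v} [Field k] [NonUnitalRing Λ] [Module k Λ]
    [IsScalarTower k Λ Λ] [SMulCommClass k Λ Λ] :
    (IsElementary k Λ ∧ CanBeLifted k Λ) ↔
      ∃ (V : Type w) (_ : Quiver.{w'} V),
        Nonempty V ∧ Finite V ∧ Finite (Quiver.Total V) ∧
        ∃ ρ : Set (PathAlgebra k V), IsRelationSet ρ ∧
          AlgIsomorphic k Λ (AlgIdeal.gen k ρ).Quot := by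
  constructor
  · rintro ⟨h, hl⟩
    obtain ⟨e, he⟩ := h.exists_unity
    let : Ring Λ :=
      { ‹NonUnitalRing Λ› with
        one := e
        one_mul := fun x => (he x).1
        mul_one := fun x => (he x).2 }
    let : Algebra k Λ := Algebra.ofModule smul_mul_assoc mul_smul_comm
    obtain ⟨V, hV, h1, h2, h3, f, hf, ⟨t, ht⟩, h4⟩ := exists_pathAlgebra_presentation h hl
    -- All of the kernel is taken as relations; it contains `0`, so it is non-empty, and it
    -- generates itself.
    refine ⟨V, hV, h1, h2, h3, (AlgIdeal.ker f : Set (PathAlgebra k V)), ⟨⟨0, map_zero f⟩, ?_, ?_⟩,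
      (AlgIdeal.quot_isomorphic _ f hf (AlgIdeal.gen_coe _)).symm⟩
    · rw [AlgIdeal.gen_coe]
      exact ⟨t, by rw [PathAlgebra.arrowIdeal_pow]; exact ht⟩
    · rw [AlgIdeal.gen_coe, PathAlgebra.arrowIdeal_pow]
      exact h4
  · rintro ⟨V, hV, h1, h2, h3, ρ, ⟨-, ⟨t, ht⟩, h4⟩, hiso⟩
    obtain ⟨φ, hφ⟩ := hiso.symm
    let π : PathAlgebra k V →ₙₐ[k] Λ := φ.comp (AlgIdeal.gen k ρ).projHom
    have hπ : Function.Surjective π := hφ.surjective.comp (AlgIdeal.projHom_surjective _)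
    have hker : AlgIdeal.ker π = AlgIdeal.gen k ρ := SetLike.ext fun z => by
      rw [← AlgIdeal.projHom_eq_zero (I := AlgIdeal.gen k ρ), ← map_eq_zero_iff φ hφ.injective]
      rfl
    rw [PathAlgebra.arrowIdeal_pow, ← hker] at ht h4
    let := Fintype.ofFinite V
    -- The unity of `Λ` is the image of the sum of the trivial paths.
    let : Ring Λ :=
      { ‹NonUnitalRing Λ› with
        one := π (∑ a, PathAlgebra.vertex k a)
        one_mul := fun y => by
          obtain ⟨z, rfl⟩ := hπ y
          exact (map_mul π _ _).symm.trans (congrArg π (PathAlgebra.sum_vertex_mul z))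
        mul_one := fun y => by
          obtain ⟨z, rfl⟩ := hπ y
          exact (map_mul π _ _).symm.trans (congrArg π (PathAlgebra.mul_sum_vertex z)) }
    let : Algebra k Λ := Algebra.ofModule smul_mul_assoc mul_smul_comm
    exact PathAlgebra.isElementary_and_canBeLifted_of_surjective π hπ ht
      (h4.trans (PathAlgebra.lengthIdeal_anti one_le_two))
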